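/- **Theorem 4.1.** For a finite graph $G$, a coloring is any map $c:V(G)\to\{\text{white},\text{black}\}$ (adjacent vertices may have the same color). Let $$W_G(t)=\sum_{c} t^{\,w(G,c)}\in\mathbb Z[t],$$ where the sum is over all colorings and $w(G,c)$ is the number of white vertices of $G$ that have an even number of black neighbors. Let $$\mathcal T(x)=\sum_{T}\frac{W_T(t)\,x^{v(T)}}{|\mathrm{Aut}\,T|}\in\mathbb Q[t][[x]],$$ where $T$ runs over all finite non-empty rooted trees up to isomorphism, $v(T)$ is the number of vertices, and isomorphisms and automorphisms preserve the root. Let $\mathcal T_w^+$, $\mathcal T_w^-$, $\mathcal T_b$ be the series obtained from $\mathcal T$ by restricting, for every $T$, the sum that defines $W_T(t)$ to those colorings of $T$ for which, respectively: the root is white and has an even number of black children; the root is white and has an odd number of black children; the root is black. Define series $(a_i,b_i,c_i)$, $i\ge 0$, in $\mathbb Q[t,t^{-1}][[x]]$ by $(a_0,b_0,c_0)=(tx,\,x^2,\,x)$ and, for $i>0$, $$a_i=t\,x\,e^{a_{i-1}+b_{i-1}}\cosh(c_{i-1}),\qquad b_i=x\,e^{a_{i-1}+b_{i-1}}\sinh(c_{i-1}),\qquad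 c_i=x\,e^{t^{-1}a_{i-1}+t\,b_{i-1}+c_{i-1}}.$$ Then all $a_i,b_i,c_i$ have constant term $0$ in $x$ (so that the recursion makes sense), and the sequences $(a_i),(b_i),(c_i)$ converge $x$-adically to power series $a_\infty,b_\infty,c_\infty\in\mathbb Q[t][[x]]$. Moreover $$\mathcal T_w^+=a_\infty,\qquad \mathcal T_w^-=b_\infty,\qquad \mathcal T_b=c_\infty,\qquad \mathcal T=a_\infty+b_\infty+c_\infty .$$ -/

import Mathlib

open scoped Polynomial PowerSeries LaurentPolynomial

namespace BlackWhite

/-! ### Colorings and the black-white polynomial -/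

/-- A black-white coloring of a vertex set: `0` is white and `1` is black. Adjacent vertices may
receive the same color. -/
abbrev Coloring (V : Type) : Type := V → ZMod 2

open Classical in
/-- The black neighbors of `v`. -/
noncomputable def blackNeighbors {V : Type} [Fintype V] (G : SimpleGraph V) (c : Coloring V)
    (v : V) : Finset V :=
  Finset.univ.filter fun w => c w = 1 ∧ G.Adj v w

open Classical in
/-- The white vertices that have an even number of black neighbors. -/
noncomputable def evenWhites {V : Type} [Fintype V] (G : SimpleGraph V) (c : Coloring V) :
    Finset V :=
  Finset.univ.filter fun v => c v = 0 ∧ Even (blackNeighbors G c v).card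

/-- The contribution of one coloring to the black-white polynomial: a factor `t` for every
white vertex with an even number of black neighbors, and `1` for every other vertex. -/
noncomputable def coloringWeight {V : Type} [Fintype V] (G : SimpleGraph V) (c : Coloring V) :
    ℤ[X] :=
  ∏ _v ∈ evenWhites G c, Polynomial.X

open Classical in
/-- The black-white polynomial `W_G(t)`: the sum of the contributions of all colorings of `G`. -/
noncomputable def bwPoly {V : Type} [Fintype V] (G : SimpleGraph V) : ℤ[X] :=
  ∑ c : Coloring V, coloringWeight G c

open Classical in
/-- The part of the black-white polynomial that comes from the colorings with property `P`. -/
noncomputable def partialBWPoly {V : Type} [Fintype V] (G : SimpleGraph V)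
    (P : Coloring V → Prop) : ℤ[X] :=
  ∑ c : Coloring V with P c, coloringWeight G c

/-! ### Rooted trees and their isomorphism classes -/

/-- A rooted tree with vertex set `Fin n`. -/
structure RTree (n : ℕ) where
  graph : SimpleGraph (Fin n)
  isTree : graph.IsTree
  root : Fin n

instance (n : ℕ) : Finite (RTree n) :=
  Finite.of_injective (β := SimpleGraph (Fin n) × Fin n) (fun T => (T.graph, T.root)) (by
    rintro ⟨G, hG, r⟩ ⟨G', hG', r'⟩ h
    simp only [Prod.mk.injEq] at h
    obtain ⟨rfl, rfl⟩ := h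
    rfl)

/-- Isomorphisms of rooted trees: graph isomorphisms that carry the root to the root. -/
abbrev RTree.Iso {n : ℕ} (T T' : RTree n) : Type :=
  {e : T.graph ≃g T'.graph // e T.root = T'.root}

/-- Automorphisms of a rooted tree. -/
abbrev RTree.Aut {n : ℕ} (T : RTree n) : Type := RTree.Iso T T

/-- Two rooted trees are equivalent if they are isomorphic as rooted trees. -/
instance RTree.setoid (n : ℕ) : Setoid (RTree n) where
  r T T' := Nonempty (RTree.Iso T T')
  iseqv :=
    { refl := fun _ => ⟨⟨SimpleGraph.Iso.refl, rfl⟩⟩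
      symm := fun {_ _} h => h.elim fun e =>
        ⟨⟨e.1.symm, e.1.toEquiv.symm_apply_eq.mpr e.2.symm⟩⟩
      trans := fun {_ _ _} h h' => h.elim fun e => h'.elim fun e' =>
        ⟨⟨e.1.trans e'.1, (congrArg e'.1 e.2).trans e'.2⟩⟩ }

/-- Isomorphism classes of rooted trees with `n` vertices. -/
abbrev RTreeClass (n : ℕ) : Type := Quotient (RTree.setoid n)

noncomputable instance (n : ℕ) : Fintype (RTreeClass n) := Fintype.ofFinite _

/-! ### The four tree series -/

/-- The series `∑_T F(T) x^{v(T)} / |Aut T|` over all rooted trees `T` up to isomorphism, for an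
isomorphism invariant `F` with values in `ℤ[t]`. -/
noncomputable def treeSeries (F : ∀ n : ℕ, RTree n → ℤ[X]) : ℚ[X]⟦X⟧ :=
  PowerSeries.mk fun n => ∑ q : RTreeClass n,
    Polynomial.C ((Nat.card (RTree.Aut q.out) : ℚ)⁻¹) *
      (F n q.out).map (Int.castRingHom ℚ)

/-- The series `𝒯` of the black-white polynomials of all rooted trees. -/
noncomputable def seriesT : ℚ[X]⟦X⟧ :=
  treeSeries fun _ T => bwPoly T.graph

/-- The contributions to `𝒯` of the trees with a coloring such that the root is white and has an
even number of black children (the children of the root are its neighbors). -/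
noncomputable def seriesWhiteEven : ℚ[X]⟦X⟧ :=
  treeSeries fun _ T => partialBWPoly T.graph fun c =>
    c T.root = 0 ∧ Even (blackNeighbors T.graph c T.root).card

/-- The contributions to `𝒯` of the trees with a coloring such that the root is white and has an
odd number of black children. -/
noncomputable def seriesWhiteOdd : ℚ[X]⟦X⟧ :=
  treeSeries fun _ T => partialBWPoly T.graph fun c =>
    c T.root = 0 ∧ Odd (blackNeighbors T.graph c T.root).card

/-- The contributions to `𝒯` of the trees with a coloring such that the root is black. -/
noncomputable def seriesBlack : ℚ[X]⟦X⟧ :=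
  treeSeries fun _ T => partialBWPoly T.graph fun c => c T.root = 1

/-! ### Power series in `x` over `ℚ[t, t⁻¹]` -/

/-- Power series in `x` with coefficients in the Laurent polynomials `ℚ[t, t⁻¹]`. -/
abbrev LSer : Type := ℚ[T;T⁻¹]⟦X⟧

/-- The constant series `t`. -/
noncomputable def t : LSer := PowerSeries.C (LaurentPolynomial.T 1)

/-- The constant series `t⁻¹`. -/
noncomputable def tInv : LSer := PowerSeries.C (LaurentPolynomial.T (-1))

/-- The series `x`. -/
noncomputable def x : LSer := PowerSeries.X

/-- `exp f = ∑ fᵏ / k!`, by substitution of `f` in the exponential series. It is meaningful for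
`f` with constant coefficient zero. -/
noncomputable def exp (f : LSer) : LSer := (PowerSeries.exp ℚ[T;T⁻¹]).subst f

/-- `cosh f = (exp f + exp (-f)) / 2`. -/
noncomputable def cosh (f : LSer) : LSer := (1 / 2 : ℚ) • (exp f + exp (-f))

/-- `sinh f = (exp f - exp (-f)) / 2`. -/
noncomputable def sinh (f : LSer) : LSer := (1 / 2 : ℚ) • (exp f - exp (-f))

/-- Convergence of a sequence of power series in the `x`-adic topology. -/
def XAdicTendsto (u : ℕ → LSer) (f : LSer) : Prop :=
  Filter.Tendsto u Filter.atTop (@nhds LSer (Ideal.span {x}).adicTopology f)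

/-- Series with coefficients in `ℚ[t]`, viewed as series with coefficients in `ℚ[t, t⁻¹]`. -/
noncomputable def toLSer : ℚ[X]⟦X⟧ →+* LSer :=
  PowerSeries.map (Polynomial.toLaurent (R := ℚ))

end BlackWhite

namespace BlackWhite

/-! ### The exponential of a power series without constant term -/

/-! Dividing by automorphisms turns a sum over isomorphism classes into an average over labelled
trees: a class of rooted trees on `n` vertices has `n! / |Aut|` labelled members
(`card_class_mul_card_aut`). So every tree series is the exponential generating function of a weight
on labelled rooted trees (`toLSer_treeSeries`).

Suppose a weight `P` is multiplicative under attaching a subtree to the root, the subtree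
contributing the weight `Q`. Cutting a marked root edge gives `(d + 1) P_{d+1} = P_d Q` for the
series by root degree, hence `P = p x exp Q`, where `p` is the weight of the single vertex
(`IsProduct.egf_eq`).

Colorings yield such weights as soon as a local identity holds at the two ends of the new edge
(`coloredWeight_isProduct`). A black root flips the parity seen by each white child, which exchanges
the factors `t` and `1`. For a white root the parity of the number `m` of black children is not
multiplicative, but `1` and `(-1) ^ m` are; their half sum and half difference produce `cosh` and
`sinh`. Thus the three tree series form a fixed point of the recursion (`whiteEven_eq`,
`whiteOdd_eq`, `black_eq`).

Each equation carries a factor `x`, so every step of the recursion gains one power of `x` in the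
agreement with the fixed point (`X_pow_dvd_recursion_sub`). -/

theorem coeff_exp_eq_sum {f : LSer} (hf : PowerSeries.constantCoeff f = 0) {n N : ℕ}
    (hN : n < N) :
    PowerSeries.coeff n (exp f) =
      ∑ d ∈ Finset.range N, (1 / (d.factorial : ℚ)) • PowerSeries.coeff n (f ^ d) := by
  rw [exp, PowerSeries.coeff_subst' (PowerSeries.HasSubst.of_constantCoeff_zero' hf)]
  rw [finsum_eq_sum_of_support_subset (s := Finset.range N)]
  · refine Finset.sum_congr rfl fun d _ => ?_
    rw [PowerSeries.coeff_exp, algebraMap_smul]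
  · intro d hd
    simp only [Finset.coe_range, Set.mem_Iio]
    by_contra h
    apply hd
    have : PowerSeries.coeff n (f ^ d) = 0 :=
      PowerSeries.X_pow_dvd_iff.mp
        (pow_dvd_pow_of_dvd (PowerSeries.X_dvd_iff.mpr hf) d) n (by omega)
    simp [this]

theorem X_pow_dvd_exp_sub_exp {f g : LSer} (hf : PowerSeries.constantCoeff f = 0)
    (hg : PowerSeries.constantCoeff g = 0) {k : ℕ} (h : PowerSeries.X ^ k ∣ f - g) :
    PowerSeries.X ^ k ∣ exp f - exp g := by
  rw [PowerSeries.X_pow_dvd_iff]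
  intro m hm
  rw [map_sub, coeff_exp_eq_sum hf (Nat.lt_succ_self m), coeff_exp_eq_sum hg (Nat.lt_succ_self m),
    ← Finset.sum_sub_distrib]
  refine Finset.sum_eq_zero fun d _ => ?_
  rw [← smul_sub, ← map_sub,
    PowerSeries.X_pow_dvd_iff.mp (h.trans (sub_dvd_pow_sub_pow f g d)) m hm, smul_zero]

/-- In two independent variables the law is an identity of coefficients, `choose (i + j) i / (i +
j)! = 1 / (i! j!)`. Substituting series for the variables then gives `exp_add`. -/
theorem subst_exp_X_add_X :
    (PowerSeries.exp ℚ[T;T⁻¹]).subst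
        (MvPowerSeries.X 0 + MvPowerSeries.X 1 : MvPowerSeries (Fin 2) ℚ[T;T⁻¹]) =
      (PowerSeries.exp ℚ[T;T⁻¹]).subst (MvPowerSeries.X 0 : MvPowerSeries (Fin 2) ℚ[T;T⁻¹]) *
      (PowerSeries.exp ℚ[T;T⁻¹]).subst (MvPowerSeries.X 1 : MvPowerSeries (Fin 2) ℚ[T;T⁻¹]) := by
  ext e
  rw [PowerSeries.coeff_subst_X_zero_add_X_one, PowerSeries.coeff_subst_X_zero_subst_mul_X_one]
  simp only [PowerSeries.coeff_exp]
  rw [← map_natCast (algebraMap ℚ ℚ[T;T⁻¹]), ← map_mul, ← map_mul]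
  congr 1
  rw [Nat.cast_add_choose]
  have := Nat.factorial_ne_zero (e 0 + e 1)
  field_simp

theorem exp_add {f g : LSer} (hf : PowerSeries.constantCoeff f = 0)
    (hg : PowerSeries.constantCoeff g = 0) : exp (f + g) = exp f * exp g := by
  have hs : MvPowerSeries.HasSubst (S := ℚ[T;T⁻¹]) (![f, g] : Fin 2 → LSer) :=
    MvPowerSeries.hasSubst_of_constantCoeff_zero fun s => by
      fin_cases s
      · exact hf
      · exact hg
  have key := congrArg (MvPowerSeries.subst ![f, g]) subst_exp_X_add_X
  have h (y : MvPowerSeries (Fin 2) ℚ[T;T⁻¹]) (hy : MvPowerSeries.constantCoeff y = 0) :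
      MvPowerSeries.subst ![f, g] ((PowerSeries.exp ℚ[T;T⁻¹]).subst y) =
        exp (MvPowerSeries.subst ![f, g] y) := by
    rw [exp, PowerSeries.subst, PowerSeries.subst,
      MvPowerSeries.subst_comp_subst_apply (PowerSeries.HasSubst.of_constantCoeff_zero hy).const hs]
  rw [MvPowerSeries.subst_mul hs, h _ (by simp), h _ (by simp), h _ (by simp),
    MvPowerSeries.subst_add hs, MvPowerSeries.subst_X hs, MvPowerSeries.subst_X hs] at key
  exact key

theorem exp_mul_cosh {f g : LSer} (hf : PowerSeries.constantCoeff f = 0)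
    (hg : PowerSeries.constantCoeff g = 0) :
    exp f * cosh g = (1 / 2 : ℚ) • (exp (f + g) + exp (f - g)) := by
  rw [cosh, sub_eq_add_neg, exp_add hf hg, exp_add hf (by simpa using hg), mul_smul_comm, mul_add]

theorem exp_mul_sinh {f g : LSer} (hf : PowerSeries.constantCoeff f = 0)
    (hg : PowerSeries.constantCoeff g = 0) :
    exp f * sinh g = (1 / 2 : ℚ) • (exp (f + g) - exp (f - g)) := by
  rw [sinh, sub_eq_add_neg f g, exp_add hf hg, exp_add hf (by simpa using hg), mul_smul_comm,
    mul_sub]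

/-- Two sequences of series whose difference is divisible by growing powers of `x` have the same
`x`-adic limit. -/
theorem xAdicTendsto_of_dvd {u : ℕ → LSer} {f : LSer}
    (h : ∀ i, (PowerSeries.X : LSer) ^ (i + 1) ∣ u i - f) : XAdicTendsto u f := by
  rw [XAdicTendsto, ((Ideal.span {x}).hasBasis_nhds_adic f).tendsto_right_iff]
  intro n _
  filter_upwards [Filter.eventually_ge_atTop n] with i hi
  refine ⟨u i - f, ?_, by simp⟩
  rw [SetLike.mem_coe, Ideal.span_singleton_pow, Ideal.mem_span_singleton]
  exact (pow_dvd_pow _ (by omega)).trans (h i)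

open SimpleGraph

/-! ### Joining two rooted trees by an edge between the roots -/

/-- The graph that arises from `G` and `H` by adding an edge between `r` and `u`. -/
def join {V W : Type} (G : SimpleGraph V) (H : SimpleGraph W) (r : V) (u : W) :
    SimpleGraph (V ⊕ W) :=
  (G ⊕g H) ⊔ SimpleGraph.edge (Sum.inl r) (Sum.inr u)

section Join

variable {V W : Type} {G : SimpleGraph V} {H : SimpleGraph W} {r : V} {u : W}

@[simp] theorem join_adj_inl_inl {a b : V} :
    (join G H r u).Adj (Sum.inl a) (Sum.inl b) ↔ G.Adj a b := by
  simp [join, SimpleGraph.edge_adj]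

@[simp] theorem join_adj_inr_inr {a b : W} :
    (join G H r u).Adj (Sum.inr a) (Sum.inr b) ↔ H.Adj a b := by
  simp [join, SimpleGraph.edge_adj]

@[simp] theorem join_adj_inl_inr {a : V} {b : W} :
    (join G H r u).Adj (Sum.inl a) (Sum.inr b) ↔ a = r ∧ b = u := by
  simp [join, SimpleGraph.edge_adj]

@[simp] theorem join_adj_inr_inl {a : V} {b : W} :
    (join G H r u).Adj (Sum.inr b) (Sum.inl a) ↔ a = r ∧ b = u := by
  rw [SimpleGraph.adj_comm, join_adj_inl_inr]

theorem isTree_join [Finite V] [Finite W] (hG : G.IsTree) (hH : H.IsTree) (r : V) (u : W) :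
    (join G H r u).IsTree := by
  have hG' := isTree_iff_connected_and_card.mp hG
  have hH' := isTree_iff_connected_and_card.mp hH
  refine isTree_iff_connected_and_card.mpr ⟨hG.connected.sum_sup_edge hH.connected, ?_⟩
  have h : (join G H r u).edgeSet = insert s(Sum.inl r, Sum.inr u) (G ⊕g H).edgeSet := by
    rw [join, SimpleGraph.edgeSet_sup, Set.union_comm,
      SimpleGraph.edgeSet_edge_of_ne (by simp), Set.insert_eq]
  rw [h, Nat.card_coe_set_eq, Set.ncard_insert_of_notMem (by simp) (Set.toFinite _),
    ← Nat.card_coe_set_eq, Nat.card_congr edgeSetSumEquiv, Nat.card_sum, Nat.card_sum]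
  -- The edge counts are `|V| - 1` and `|W| - 1`, plus one for the new edge.
  omega

/-- `G` has exactly one edge between `S` and its complement, from `r ∈ S` to `u ∉ S`. -/
def Cut {V : Type} (S : Set V) (G : SimpleGraph V) (r u : V) : Prop :=
  r ∈ S ∧ u ∉ S ∧ ∀ a ∈ S, ∀ b ∉ S, G.Adj a b ↔ a = r ∧ b = u

theorem cut_join : Cut (Set.range Sum.inl) (join G H r u) (Sum.inl r) (Sum.inr u) := by
  refine ⟨⟨r, rfl⟩, by simp, ?_⟩
  rintro _ ⟨a, rfl⟩ (b | b) hb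
  · exact absurd ⟨b, rfl⟩ hb
  · simp

theorem eq_join_of_cut {K : SimpleGraph (V ⊕ W)}
    (h : Cut (Set.range Sum.inl) K (Sum.inl r) (Sum.inr u)) :
    K = join (K.comap Sum.inl) (K.comap Sum.inr) r u := by
  ext a b
  have h' (a : V) (b : W) : K.Adj (Sum.inl a) (Sum.inr b) ↔ a = r ∧ b = u := by
    simpa using h.2.2 (Sum.inl a) ⟨a, rfl⟩ (Sum.inr b) (by simp)
  rcases a with a | a <;> rcases b with b | b
  · simp
  · simp [h']
  · rw [K.adj_comm]
    simp [h']
  · simp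

theorem isTree_left_of_isTree_join (h : (join G H r u).IsTree) : G.IsTree := by
  have hG : G = (join G H r u).comap Sum.inl := by
    ext a b
    simp
  have : Nonempty V := ⟨r⟩
  refine ⟨⟨fun a b => ?_⟩, ?_⟩
  · let f : V ⊕ W → V := Sum.elim id fun _ => r
    have key (p q : V ⊕ W) (w : (join G H r u).Walk p q) : G.Reachable (f p) (f q) := by
      induction w with
      | nil => exact Reachable.refl _
      | @cons p p' q hpq _ ih =>
        refine Reachable.trans ?_ ih
        rcases p with p | p <;> rcases p' with p' | p'
        · exact (join_adj_inl_inl.mp hpq).reachable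
        · rw [(join_adj_inl_inr.mp hpq).1]
          exact Reachable.refl _
        · rw [(join_adj_inr_inl.mp hpq).1]
          exact Reachable.refl _
        · exact Reachable.refl _
    obtain ⟨w⟩ := h.connected (Sum.inl a) (Sum.inl b)
    exact key _ _ w
  · rw [hG]
    exact h.isAcyclic.of_comap ⟨Sum.inl, Sum.inl_injective⟩

/-- Joining is symmetric. -/
def joinComm (G : SimpleGraph V) (H : SimpleGraph W) (r : V) (u : W) :
    join G H r u ≃g join H G u r where
  toEquiv := Equiv.sumComm V W
  map_rel_iff' {a b} := by
    rcases a with a | a <;> rcases b with b | b <;> simp [and_comm]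

theorem isTree_join_iff [Finite V] [Finite W] :
    (join G H r u).IsTree ↔ G.IsTree ∧ H.IsTree :=
  ⟨fun h => ⟨isTree_left_of_isTree_join h,
    isTree_left_of_isTree_join ((joinComm G H r u).isTree_iff.mp h)⟩,
    fun h => isTree_join h.1 h.2 r u⟩

end Join

/-- Every edge of a tree is the only edge across a unique cut. -/
theorem existsUnique_cut {V : Type} {G : SimpleGraph V} (hG : G.IsTree) {r u : V}
    (h : G.Adj r u) : ∃! S : Set V, Cut S G r u := by
  -- Every edge of a tree is a bridge; the cut will be the component of `r` after its deletion.
  have hb : ¬ (G \ SimpleGraph.edge r u).Reachable r u := by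
    have := isAcyclic_iff_forall_adj_isBridge.mp hG.isAcyclic h
    rw [isBridge_iff] at this
    rwa [SimpleGraph.deleteEdges, ← SimpleGraph.edge] at this
  have hadj {a b : V} (hab : G.Adj a b) (hne : ¬ (G \ SimpleGraph.edge r u).Adj a b) :
      (a = r ∧ b = u) ∨ (a = u ∧ b = r) := by
    simp only [SimpleGraph.sdiff_adj, hab, true_and, not_not, SimpleGraph.edge_adj] at hne
    tauto
  refine ⟨{v | (G \ SimpleGraph.edge r u).Reachable r v}, ⟨Reachable.refl _, hb, ?_⟩, ?_⟩
  · intro a ha b hb'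
    constructor
    · intro hab
      by_cases hne : (G \ SimpleGraph.edge r u).Adj a b
      · exact absurd (Reachable.trans ha hne.reachable) hb'
      · rcases hadj hab hne with h | h
        · exact h
        · exact absurd (h.1 ▸ ha) hb
    · rintro ⟨rfl, rfl⟩
      exact h
  · intro S hS
    -- Any cut is a union of components of the graph without the edge.
    have hinv (a b : V) (hab : (G \ SimpleGraph.edge r u).Reachable a b) : a ∈ S ↔ b ∈ S := by
      obtain ⟨w⟩ := hab
      induction w with
      | nil => rfl
      | @cons a a' b haa' _ ih =>
        rw [← ih]
        simp only [SimpleGraph.sdiff_adj, SimpleGraph.edge_adj] at haa'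
        by_contra hc
        have hne := h.ne
        by_cases ha : a ∈ S
        · have := (hS.2.2 a ha a' (by tauto)).mp haa'.1
          have := haa'.2
          have := haa'.1.ne
          tauto
        · have := (hS.2.2 a' (by tauto) a ha).mp haa'.1.symm
          have := haa'.2
          have := haa'.1.ne
          tauto
    ext v
    refine ⟨fun hv => ?_, fun hv => (hinv _ _ hv).mp hS.1⟩
    -- There are only two such components, that of `r` and that of `u`, so a cut containing `r` but
    -- not `u` is determined.
    have key (v r' : V) (w : G.Walk v r') (hr' : r' = r) :
        (G \ SimpleGraph.edge r u).Reachable v r ∨ (G \ SimpleGraph.edge r u).Reachable v u := by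
      induction w with
      | nil => exact Or.inl (hr' ▸ Reachable.refl _)
      | @cons a a' b haa' _ ih =>
        by_cases hne : (G \ SimpleGraph.edge r u).Adj a a'
        · exact (ih hr').imp hne.reachable.trans hne.reachable.trans
        · rcases hadj haa' hne with h | h
          · exact Or.inl (h.1 ▸ Reachable.refl _)
          · exact Or.inr (h.1 ▸ Reachable.refl _)
    obtain ⟨w⟩ := hG.connected v r
    rcases key v r w rfl with h' | h'
    · exact h'.symm
    · exact absurd ((hinv _ _ h').mp hv) hS.2.1

/-! ### Weighted sums over rooted trees -/

/-- A weight on finite rooted graphs. -/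
abbrev RootedWeight (R : Type*) := ∀ (V : Type) [Fintype V], SimpleGraph V → V → R

namespace RootedWeight

variable {R : Type*} [CommRing R]

/-- Invariance of a weight under isomorphisms. -/
def IsInvariant (P : RootedWeight R) : Prop :=
  ∀ (V W : Type) [Fintype V] [Fintype W] (G : SimpleGraph V) (H : SimpleGraph W) (e : G ≃g H)
    (r : V), P W H (e r) = P V G r

/-- Joining the roots `r` of `G` and `u` of `H` by an edge gives a graph with root `r` whose
`P`-weight is the product of the `P'`-weight of `G` and the `Q`-weight of `H`. -/
def IsProduct (P P' Q : RootedWeight R) : Prop :=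
  ∀ (V W : Type) [Fintype V] [Fintype W] (G : SimpleGraph V) (H : SimpleGraph W)
    (r : V) (u : W), P (V ⊕ W) (join G H r u) (Sum.inl r) = P' V G r * Q W H u

open Classical in
/-- The sum of the weights of all rooted trees with vertex set `V`. -/
noncomputable def treeSum (P : RootedWeight R) (V : Type) [Fintype V] : R :=
  ∑ p : SimpleGraph V × V, if p.1.IsTree then P V p.1 p.2 else 0

theorem IsInvariant.treeSum_congr {P : RootedWeight R} (hP : P.IsInvariant) {V W : Type}
    [Fintype V] [Fintype W] (e : V ≃ W) : P.treeSum V = P.treeSum W := by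
  classical
  rw [treeSum, treeSum]
  refine Fintype.sum_equiv (e.simpleGraph.prodCongr e) _ _ ?_
  rintro ⟨G, r⟩
  let f : G ≃g e.simpleGraph G :=
    { toEquiv := e
      map_rel_iff' := by simp [Equiv.simpleGraph] }
  simp only [Equiv.prodCongr_apply, Prod.map_apply]
  rw [f.isTree_iff]
  congr 1
  exact (hP V W G _ f r).symm

open Classical in
/-- The sum over the rooted trees with vertex set `V` and a marked child of the root, such that
the edge to this child is the only edge across the cut `S`. -/
noncomputable def cutSum (P : RootedWeight R) (V : Type) [Fintype V] (S : Set V) : R :=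
  ∑ p : SimpleGraph V × V × V, if p.1.IsTree ∧ Cut S p.1 p.2.1 p.2.2 then P V p.1 p.2.1 else 0

theorem IsInvariant.cutSum_congr {P : RootedWeight R} (hP : P.IsInvariant) {V W : Type}
    [Fintype V] [Fintype W] (e : V ≃ W) (S : Set W) : P.cutSum V (e ⁻¹' S) = P.cutSum W S := by
  classical
  rw [cutSum, cutSum]
  refine Fintype.sum_equiv (e.simpleGraph.prodCongr (e.prodCongr e)) _ _ ?_
  rintro ⟨G, r, u⟩
  let f : G ≃g e.simpleGraph G :=
    { toEquiv := e
      map_rel_iff' := by simp [Equiv.simpleGraph] }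
  simp only [Equiv.prodCongr_apply, Prod.map_apply]
  rw [f.isTree_iff]
  have : Cut (e ⁻¹' S) G r u ↔ Cut S (e.simpleGraph G) (e r) (e u) := by
    simp only [Cut, Set.mem_preimage, e.surjective.forall, e.injective.eq_iff]
    refine and_congr_right fun _ => and_congr_right fun _ => ?_
    refine forall_congr' fun a => forall_congr' fun _ => forall_congr' fun b =>
      forall_congr' fun _ => ?_
    rw [← f.map_adj_iff]
    rfl
  rw [this]
  congr 1
  exact (hP V W G _ f r).symm

/-- A tree with a single edge across the cut is the join of its restrictions to the two sides, and
it is a tree exactly when both restrictions are. -/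
theorem IsProduct.cutSum_sum {P P' Q : RootedWeight R} (h : P.IsProduct P' Q) (V W : Type)
    [Fintype V] [Fintype W] :
    P.cutSum (V ⊕ W) (Set.range Sum.inl) = P'.treeSum V * Q.treeSum W := by
  classical
  rw [cutSum, treeSum, treeSum, Finset.sum_mul_sum, ← Finset.sum_product',
    ← Finset.sum_filter]
  simp only [ite_zero_mul_ite_zero]
  rw [← Finset.sum_filter]
  symm
  refine Finset.sum_bij
    (fun p _ => (join p.1.1 p.2.1 p.1.2 p.2.2, Sum.inl p.1.2, Sum.inr p.2.2)) ?_ ?_ ?_ ?_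
  · rintro ⟨⟨G, r⟩, H, u⟩ hp
    simp only [Finset.univ_product_univ, Finset.mem_filter, Finset.mem_univ, true_and] at hp ⊢
    exact ⟨isTree_join hp.1 hp.2 r u, cut_join⟩
  · rintro ⟨⟨G, r⟩, H, u⟩ _ ⟨⟨G', r'⟩, H', u'⟩ _ he
    simp only [Prod.mk.injEq, Sum.inl.injEq, Sum.inr.injEq] at he
    obtain ⟨he, rfl, rfl⟩ := he
    have hG : G = G' := by
      ext a b
      rw [← join_adj_inl_inl (G := G) (H := H) (r := r) (u := u), he, join_adj_inl_inl]
    have hH : H = H' := by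
      ext a b
      rw [← join_adj_inr_inr (G := G) (H := H) (r := r) (u := u), he, join_adj_inr_inr]
    rw [hG, hH]
  · rintro ⟨K, r, u⟩ hp
    simp only [Finset.mem_filter, Finset.mem_univ, true_and] at hp
    obtain ⟨hK, hc⟩ := hp
    obtain ⟨r, rfl⟩ := hc.1
    obtain u | u := u
    · exact absurd ⟨u, rfl⟩ hc.2.1
    have := eq_join_of_cut hc
    refine ⟨((K.comap Sum.inl, r), (K.comap Sum.inr, u)), ?_, ?_⟩
    · rw [this, isTree_join_iff] at hK
      simpa using hK
    · simp only [← this]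
  · rintro ⟨⟨G, r⟩, H, u⟩ _
    exact (h V W G H r u).symm

theorem IsProduct.cutSum_eq {P P' Q : RootedWeight R} (h : P.IsProduct P' Q) (hP : P.IsInvariant)
    (hP' : P'.IsInvariant) (hQ : Q.IsInvariant) {n : ℕ} (S : Finset (Fin n)) :
    P.cutSum (Fin n) (S : Set (Fin n)) =
      P'.treeSum (Fin S.card) * Q.treeSum (Fin (n - S.card)) := by
  classical
  let e : S ⊕ (Sᶜ : Finset (Fin n)) ≃ Fin n :=
    (Equiv.sumCongr (Equiv.refl _) (Equiv.subtypeEquivRight (by simp))).trans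
      (Equiv.sumCompl (fun a => a ∈ S))
  rw [← hP.cutSum_congr e]
  have : e ⁻¹' (S : Set (Fin n)) = Set.range Sum.inl := by
    ext (a | a)
    · simp [e]
    · simpa [e] using Finset.mem_compl.mp a.2
  rw [this, h.cutSum_sum, hP'.treeSum_congr (S.equivFin),
    hQ.treeSum_congr ((Sᶜ).equivFinOfCardEq (n := n - S.card) (by simp [Finset.card_compl]))]

/-- Marking a child of the root of every tree. -/
theorem treeSum_degree_mul (P : RootedWeight R) (V : Type) [Fintype V] :
    treeSum (fun V _ G r => ((G.neighborSet r).ncard : R) * P V G r) V =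
      ∑ S : Finset V, P.cutSum V (S : Set V) := by
  classical
  simp only [cutSum]
  rw [Finset.sum_comm, treeSum, Fintype.sum_prod_type, Fintype.sum_prod_type]
  refine Finset.sum_congr rfl fun G _ => ?_
  rw [Fintype.sum_prod_type]
  refine Finset.sum_congr rfl fun r _ => ?_
  by_cases hG : G.IsTree
  swap
  · simp [hG]
  simp only [hG, true_and, if_true]
  -- A neighbor `u` of the root is counted by exactly one cut and any other vertex by none, so the
  -- sum over `u` produces the degree.
  have hu (u : V) : (∑ S : Finset V, if Cut (S : Set V) G r u
      then P V G r else 0) = if G.Adj r u then P V G r else 0 := by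
    split_ifs with hadj
    · obtain ⟨S, hS, huniq⟩ := existsUnique_cut hG hadj
      rw [Finset.sum_eq_single S.toFinset]
      · simp [hS]
      · intro S' _ hne
        rw [if_neg]
        intro hc
        apply hne
        rw [← Finset.coe_inj, huniq _ hc, Set.coe_toFinset]
      · simp
    · refine Finset.sum_eq_zero fun S _ => if_neg fun hc => hadj ?_
      exact (hc.2.2 r hc.1 u hc.2.1).mpr ⟨rfl, rfl⟩
  simp only [hu]
  rw [← Finset.sum_filter, Finset.sum_const, nsmul_eq_mul]
  congr 2
  rw [← Set.ncard_coe_finset]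
  congr 1
  ext
  simp

/-- The sum of `deg(root) · P` over all rooted trees with `n` vertices, by cutting off a child of
the root. -/
theorem IsProduct.treeSum_degree_mul {P P' Q : RootedWeight R} (h : P.IsProduct P' Q)
    (hP : P.IsInvariant) (hP' : P'.IsInvariant) (hQ : Q.IsInvariant) (n : ℕ) :
    treeSum (fun V _ G r => ((G.neighborSet r).ncard : R) * P V G r) (Fin n) =
      ∑ k ∈ Finset.range (n + 1), n.choose k • (P'.treeSum (Fin k) * Q.treeSum (Fin (n - k))) := by
  have hsum := Finset.sum_powerset_apply_card
    (fun k => P'.treeSum (Fin k) * Q.treeSum (Fin (n - k))) (x := (Finset.univ : Finset (Fin n)))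
  rw [Finset.card_univ, Fintype.card_fin] at hsum
  rw [← hsum, Finset.powerset_univ, RootedWeight.treeSum_degree_mul]
  exact Finset.sum_congr rfl fun S _ => h.cutSum_eq hP hP' hQ S

end RootedWeight

/-! ### Root degree and the exponential formula. -/

theorem coeff_rat_smul (q : ℚ) (f : LSer) (n : ℕ) :
    PowerSeries.coeff n (q • f) = q • PowerSeries.coeff n f := rfl

namespace RootedWeight

/-- The restriction of a weight to the graphs with root degree `d`. -/
noncomputable def ofDegree {R : Type*} [CommRing R] (P : RootedWeight R) (d : ℕ) :
    RootedWeight R :=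
  fun V _ G r => if (G.neighborSet r).ncard = d then P V G r else 0

theorem IsInvariant.ofDegree {R : Type*} [CommRing R] {P : RootedWeight R} (hP : P.IsInvariant)
    (d : ℕ) : (P.ofDegree d).IsInvariant := by
  intro V W _ _ G H e r
  have h : (H.neighborSet (e r)).ncard = (G.neighborSet r).ncard := by
    rw [← Nat.card_coe_set_eq, ← Nat.card_coe_set_eq]
    exact (Nat.card_congr (e.mapNeighborSet r)).symm
  rw [RootedWeight.ofDegree, RootedWeight.ofDegree, h, hP V W G H e r]

theorem ncard_neighborSet_join {V W : Type} [Finite V] (G : SimpleGraph V) (H : SimpleGraph W)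
    (r : V) (u : W) : ((join G H r u).neighborSet (Sum.inl r)).ncard =
      (G.neighborSet r).ncard + 1 := by
  have h : (join G H r u).neighborSet (Sum.inl r) =
      insert (Sum.inr u) (Sum.inl '' G.neighborSet r) := by
    ext (a | a) <;> simp
  rw [h, Set.ncard_insert_of_notMem (by simp) (Set.toFinite _),
    Set.ncard_image_of_injective _ Sum.inl_injective]

theorem IsProduct.ofDegree {R : Type*} [CommRing R] {P P' Q : RootedWeight R}
    (h : P.IsProduct P' Q) (d : ℕ) : (P.ofDegree (d + 1)).IsProduct (P'.ofDegree d) Q := by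
  intro V W _ _ G H r u
  rw [RootedWeight.ofDegree, RootedWeight.ofDegree, ncard_neighborSet_join, h V W G H r u, ite_mul,
    zero_mul]
  simp

theorem treeSum_ofDegree_mul {R : Type*} [CommRing R] (P : RootedWeight R) (d : ℕ) (V : Type)
    [Fintype V] :
    treeSum (fun V _ G r => ((G.neighborSet r).ncard : R) * P.ofDegree d V G r) V =
      d * (P.ofDegree d).treeSum V := by
  simp only [treeSum]
  rw [Finset.mul_sum]
  refine Finset.sum_congr rfl fun p _ => ?_
  rw [mul_ite, mul_zero]
  congr 1
  rw [RootedWeight.ofDegree]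
  split_ifs with h
  · rw [h]
  · simp

theorem treeSum_eq_sum_ofDegree {R : Type*} [CommRing R] (P : RootedWeight R) (V : Type)
    [Fintype V] {N : ℕ} (hN : Fintype.card V < N) :
    P.treeSum V = ∑ d ∈ Finset.range N, (P.ofDegree d).treeSum V := by
  simp only [treeSum]
  rw [Finset.sum_comm]
  refine Finset.sum_congr rfl fun p _ => ?_
  split_ifs
  · simp only [RootedWeight.ofDegree]
    rw [Finset.sum_ite_eq, if_pos]
    rw [Finset.mem_range]
    refine lt_of_le_of_lt ?_ hN
    rw [← Nat.card_eq_fintype_card]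
    exact Set.ncard_le_card _
  · simp

theorem treeSum_of_subsingleton {R : Type*} [CommRing R] (P : RootedWeight R) {V : Type}
    [Fintype V] [Subsingleton V] (r : V) : P.treeSum V = P V ⊥ r := by
  have : Nonempty V := ⟨r⟩
  -- The `Fintype` instance is arbitrary here so that the fact applies to the classical one inside
  -- `treeSum`.
  have h (_ : Fintype (SimpleGraph V × V)) (f : SimpleGraph V × V → R) :
      ∑ q, f q = f (⊥, r) := Fintype.sum_subsingleton f _
  rw [treeSum]
  exact (h _ _).trans (if_pos IsTree.of_subsingleton)

/-- The exponential generating function of a weight on rooted trees. -/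
noncomputable def egf (P : RootedWeight ℚ[T;T⁻¹]) : LSer :=
  PowerSeries.mk fun n => (1 / (n.factorial : ℚ)) • P.treeSum (Fin n)

theorem constantCoeff_egf (P : RootedWeight ℚ[T;T⁻¹]) :
    PowerSeries.constantCoeff P.egf = 0 := by
  rw [← PowerSeries.coeff_zero_eq_constantCoeff_apply, egf, PowerSeries.coeff_mk, treeSum,
    Finset.univ_eq_empty, Finset.sum_empty, smul_zero]

variable {P Q : RootedWeight ℚ[T;T⁻¹]}

/-- A tree of root degree `d + 1` can be cut at `d + 1` root edges; the sum over cuts is a binomial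
convolution, which is the product of exponential generating functions. -/
theorem IsProduct.egf_ofDegree_succ (h : P.IsProduct P Q)
    (hP : P.IsInvariant) (hQ : Q.IsInvariant) (d : ℕ) :
    ((d + 1 : ℕ) : ℚ) • (P.ofDegree (d + 1)).egf = (P.ofDegree d).egf * Q.egf := by
  ext1 n
  have key := (h.ofDegree d).treeSum_degree_mul (hP.ofDegree _) (hP.ofDegree _) hQ n
  rw [treeSum_ofDegree_mul] at key
  rw [PowerSeries.coeff_mul, Finset.Nat.sum_antidiagonal_eq_sum_range_succ_mk, coeff_rat_smul]
  simp only [egf, PowerSeries.coeff_mk]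
  rw [smul_comm, Nat.cast_smul_eq_nsmul, nsmul_eq_mul, key, Finset.smul_sum]
  refine Finset.sum_congr rfl fun k hk => ?_
  rw [← Nat.cast_smul_eq_nsmul ℚ, smul_smul, smul_mul_smul_comm]
  congr 1
  rw [Finset.mem_range] at hk
  rw [Nat.cast_choose ℚ (by omega : k ≤ n)]
  have := Nat.factorial_ne_zero n
  field_simp

/-- Connectedness leaves the single vertex as the only tree whose root has degree zero. -/
theorem egf_ofDegree_zero {p : ℚ[T;T⁻¹]}
    (hp : ∀ (V : Type) [Fintype V] [Subsingleton V] (G : SimpleGraph V) (r : V), P V G r = p) :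
    (P.ofDegree 0).egf = PowerSeries.C p * PowerSeries.X := by
  classical
  ext1 n
  rw [PowerSeries.coeff_C_mul, PowerSeries.coeff_X, egf, PowerSeries.coeff_mk]
  split_ifs with hn
  · subst hn
    have h : (P.ofDegree 0) (Fin 1) ⊥ 0 = p := by
      rw [RootedWeight.ofDegree, if_pos, hp]
      have : (⊥ : SimpleGraph (Fin 1)).neighborSet 0 = ∅ := by
        ext v
        simp
      rw [this, Set.ncard_empty]
    rw [treeSum_of_subsingleton _ (0 : Fin 1), h]
    simp
  · rw [treeSum, Finset.sum_eq_zero, smul_zero, mul_zero]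
    rintro ⟨G, r⟩ _
    refine ite_eq_right_iff.mpr fun hG => if_neg fun h => ?_
    have : 2 ≤ n := by
      have := r.pos
      omega
    have : Nontrivial (Fin n) := Fin.nontrivial_iff_two_le.mpr this
    obtain ⟨v, hv⟩ := hG.connected.preconnected.exists_adj_of_nontrivial r
    rw [Set.ncard_eq_zero (Set.toFinite _)] at h
    exact Set.notMem_empty v (h ▸ hv)

theorem IsProduct.egf_ofDegree (h : P.IsProduct P Q) (hP : P.IsInvariant) (hQ : Q.IsInvariant)
    {p : ℚ[T;T⁻¹]}
    (hp : ∀ (V : Type) [Fintype V] [Subsingleton V] (G : SimpleGraph V) (r : V), P V G r = p)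
    (d : ℕ) :
    (P.ofDegree d).egf =
      PowerSeries.C p * PowerSeries.X * ((1 / (d.factorial : ℚ)) • Q.egf ^ d) := by
  induction d with
  | zero => simp [egf_ofDegree_zero hp]
  | succ d ih =>
    have hd : ((d + 1 : ℕ) : ℚ) ≠ 0 := by positivity
    rw [← inv_smul_smul₀ hd (P.ofDegree (d + 1)).egf, h.egf_ofDegree_succ hP hQ, ih,
      mul_assoc, smul_mul_assoc, ← pow_succ, ← mul_smul_comm, smul_smul]
    congr 2
    rw [Nat.factorial_succ]
    push_cast
    field_simp

/-- The exponential formula for rooted trees. -/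
theorem IsProduct.egf_eq (h : P.IsProduct P Q) (hP : P.IsInvariant) (hQ : Q.IsInvariant)
    {p : ℚ[T;T⁻¹]}
    (hp : ∀ (V : Type) [Fintype V] [Subsingleton V] (G : SimpleGraph V) (r : V), P V G r = p) :
    P.egf = PowerSeries.C p * PowerSeries.X * exp Q.egf := by
  ext1 n
  have h1 : PowerSeries.coeff n P.egf =
      ∑ d ∈ Finset.range (n + 1), PowerSeries.coeff n (P.ofDegree d).egf := by
    simp only [egf, PowerSeries.coeff_mk]
    rw [treeSum_eq_sum_ofDegree P (Fin n) (N := n + 1) (by simp), Finset.smul_sum]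
  rw [h1]
  simp only [h.egf_ofDegree hP hQ hp]
  rcases n with _ | n
  · simp
  · simp only [mul_assoc, PowerSeries.coeff_C_mul, PowerSeries.coeff_succ_X_mul]
    -- The factor `x` lowers the coefficient index by one but not the range of degrees; the extra
    -- term of the exponential sum vanishes.
    rw [coeff_exp_eq_sum Q.constantCoeff_egf (by omega : n < n + 1 + 1), Finset.mul_sum]
    simp only [coeff_rat_smul]

end RootedWeight

/-! ### From isomorphism classes to labelled trees -/

instance {n : ℕ} (T T' : RTree n) : Finite (RTree.Iso T T') :=
  Finite.of_injective (fun e => (e.1.toEquiv : Equiv.Perm (Fin n))) fun _ _ h =>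
    Subtype.ext (RelIso.ext fun v => congrArg (fun σ : Equiv.Perm (Fin n) => σ v) h)

/-- Orbit counting: a permutation `σ` of the vertices is the same as a labelled tree isomorphic to
`T₀` together with an isomorphism from `T₀` to it, and each such tree admits `|Aut T₀|`
isomorphisms. -/
theorem card_class_mul_card_aut {n : ℕ} (T₀ : RTree n) :
    Nat.card {T : RTree n // T ≈ T₀} * Nat.card T₀.Aut = n.factorial := by
  let Ψ : (Σ T : {T : RTree n // T ≈ T₀}, RTree.Iso T₀ T.1) → Equiv.Perm (Fin n) :=
    fun p => p.2.1.toEquiv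
  have hinj : Function.Injective Ψ := by
    rintro ⟨⟨⟨G, hG, r⟩, hT⟩, ⟨e, he⟩⟩ ⟨⟨⟨G', hG', r'⟩, hT'⟩, ⟨e', he'⟩⟩ h
    have h' : e.toEquiv = e'.toEquiv := h
    have hfun (v : Fin n) : e v = e' v := congrArg (fun σ : Equiv.Perm (Fin n) => σ v) h'
    obtain rfl : r = r' := he.symm.trans ((hfun _).trans he')
    obtain rfl : G = G' := by
      ext a b
      obtain ⟨a, rfl⟩ := e.surjective a
      obtain ⟨b, rfl⟩ := e.surjective b
      rw [e.map_adj_iff, hfun, hfun]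
      exact e'.map_adj_iff.symm
    obtain rfl : e = e' := RelIso.ext hfun
    rfl
  have hsurj : Function.Surjective Ψ := by
    intro σ
    let f : T₀.graph ≃g T₀.graph.map σ.toEmbedding := SimpleGraph.Iso.map σ T₀.graph
    let T : RTree n := ⟨T₀.graph.map σ.toEmbedding, f.isTree_iff.mp T₀.isTree, σ T₀.root⟩
    let i : RTree.Iso T₀ T := ⟨f, rfl⟩
    exact ⟨⟨⟨T, Setoid.symm ⟨i⟩⟩, i⟩, Equiv.ext fun _ => rfl⟩
  have hcard := Nat.card_congr (Equiv.ofBijective Ψ ⟨hinj, hsurj⟩)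
  have hiso (T : {T : RTree n // T ≈ T₀}) : Nat.card (RTree.Iso T₀ T.1) = Nat.card T₀.Aut := by
    obtain ⟨T, ⟨i⟩⟩ := T
    exact Nat.card_congr
      { toFun := fun e => ⟨e.1.trans i.1, (congrArg i.1 e.2).trans i.2⟩
        invFun := fun e => ⟨e.1.trans i.1.symm,
          (congrArg i.1.symm e.2).trans (i.1.toEquiv.symm_apply_eq.mpr i.2.symm)⟩
        left_inv := fun e => Subtype.ext (RelIso.ext fun v => by simp)
        right_inv := fun e => Subtype.ext (RelIso.ext fun v => by simp) }
  have := Fintype.ofFinite {T : RTree n // T ≈ T₀}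
  rw [Nat.card_sigma, Finset.sum_congr rfl fun T _ => hiso T, Finset.sum_const, Finset.card_univ,
    smul_eq_mul, ← Nat.card_eq_fintype_card, Nat.card_perm, Nat.card_eq_fintype_card (α := Fin n),
    Fintype.card_fin] at hcard
  exact hcard

theorem sum_class_inv_card_aut_smul {n : ℕ} {M : Type*} [AddCommGroup M] [Module ℚ M]
    [Fintype (RTree n)] (F : RTree n → M) (hF : ∀ T T' : RTree n, T ≈ T' → F T = F T') :
    ∑ q : RTreeClass n, ((Nat.card q.out.Aut : ℚ)⁻¹) • F q.out =
      (1 / (n.factorial : ℚ)) • ∑ T : RTree n, F T := by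
  classical
  rw [← Finset.sum_fiberwise Finset.univ (fun T : RTree n => (⟦T⟧ : RTreeClass n)) F,
    Finset.smul_sum]
  refine Finset.sum_congr rfl fun q _ => ?_
  have hmem (T : RTree n) : (⟦T⟧ : RTreeClass n) = q ↔ T ≈ q.out := by
    conv_lhs => rw [← q.out_eq]
    exact Quotient.eq
  rw [Finset.sum_congr rfl (g := fun _ => F q.out) fun T hT => hF _ _
    ((hmem T).mp (Finset.mem_filter.mp hT).2), Finset.sum_const, ← Nat.cast_smul_eq_nsmul ℚ,
    smul_smul]
  congr 1
  have h := card_class_mul_card_aut q.out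
  have hc : (Finset.univ.filter fun T : RTree n => (⟦T⟧ : RTreeClass n) = q).card =
      Nat.card {T : RTree n // T ≈ q.out} := by
    rw [Nat.card_eq_fintype_card, Fintype.card_subtype]
    simp only [hmem]
  rw [hc, ← h]
  have h0 : Nat.card {T : RTree n // T ≈ q.out} * Nat.card q.out.Aut ≠ 0 :=
    h ▸ Nat.factorial_ne_zero n
  have h1 := left_ne_zero_of_mul h0
  have h2 := right_ne_zero_of_mul h0
  push_cast
  field_simp

theorem toLSer_treeSeries {F : ∀ n : ℕ, RTree n → ℤ[X]} {P : RootedWeight ℚ[T;T⁻¹]}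
    (hP : P.IsInvariant)
    (h : ∀ (n : ℕ) (T : RTree n),
      Polynomial.toLaurent ((F n T).map (Int.castRingHom ℚ)) = P (Fin n) T.graph T.root) :
    toLSer (treeSeries F) = P.egf := by
  classical
  ext1 n
  have := Fintype.ofFinite (RTree n)
  rw [toLSer, PowerSeries.coeff_map, treeSeries, PowerSeries.coeff_mk, map_sum,
    RootedWeight.egf, PowerSeries.coeff_mk]
  have hsum : P.treeSum (Fin n) = ∑ T : RTree n, P (Fin n) T.graph T.root := by
    rw [RootedWeight.treeSum, ← Finset.sum_filter]
    symm
    refine Finset.sum_bij (fun T _ => (T.graph, T.root)) ?_ ?_ ?_ ?_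
    · intro T _
      simpa using T.isTree
    · rintro ⟨G, hG, r⟩ _ ⟨G', hG', r'⟩ _ he
      simp only [Prod.mk.injEq] at he
      obtain ⟨rfl, rfl⟩ := he
      rfl
    · rintro ⟨G, r⟩ hp
      exact ⟨⟨G, by simpa using hp, r⟩, Finset.mem_univ _, rfl⟩
    · intro T _
      rfl
  rw [hsum, ← sum_class_inv_card_aut_smul (fun T : RTree n => P (Fin n) T.graph T.root)]
  · refine Finset.sum_congr rfl fun q _ => ?_
    rw [map_mul, h, Polynomial.toLaurent_C, LaurentPolynomial.smul_eq_C_mul]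
  · rintro T T' ⟨e, he⟩
    rw [← hP _ _ _ _ e T.root, he]

/-! ### Weights that come from colorings -/

/-- The factor of a vertex of color `a` with `m` black neighbors. -/
noncomputable def vertexFactor (a : ZMod 2) (m : ℕ) : ℚ[T;T⁻¹] :=
  if a = 0 ∧ Even m then LaurentPolynomial.T 1 else 1

open Classical in
/-- The sum over all colorings of a rooted graph, where a root of color `a` with `m` black
neighbors contributes the factor `ρ a m` in place of `vertexFactor a m`. -/
noncomputable def coloredWeight (ρ : ZMod 2 → ℕ → ℚ[T;T⁻¹]) : RootedWeight ℚ[T;T⁻¹] :=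
  fun V _ G r => ∑ c : Coloring V, ρ (c r) (blackNeighbors G c r).card *
    ∏ v ∈ Finset.univ.erase r, vertexFactor (c v) (blackNeighbors G c v).card

theorem coloredWeight_apply (ρ : ZMod 2 → ℕ → ℚ[T;T⁻¹]) {V : Type} [Fintype V] [DecidableEq V]
    (G : SimpleGraph V) (r : V) : coloredWeight ρ V G r =
      ∑ c : Coloring V, ρ (c r) (blackNeighbors G c r).card *
        ∏ v ∈ Finset.univ.erase r, vertexFactor (c v) (blackNeighbors G c v).card := by
  rw [coloredWeight]
  congr!

theorem card_blackNeighbors_iso {V W : Type} [Fintype V] [Fintype W] {G : SimpleGraph V}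
    {H : SimpleGraph W} (e : G ≃g H) (c : Coloring W) (v : V) :
    (blackNeighbors H c (e v)).card = (blackNeighbors G (c ∘ e) v).card := by
  classical
  symm
  refine Finset.card_bij (fun w _ => e w) ?_ (fun _ _ _ _ h => e.injective h) ?_
  · intro w hw
    simpa [blackNeighbors, e.map_adj_iff] using hw
  · intro w hw
    obtain ⟨w, rfl⟩ := e.surjective w
    exact ⟨w, by simpa [blackNeighbors, e.map_adj_iff] using hw, rfl⟩

theorem coloredWeight_isInvariant (ρ : ZMod 2 → ℕ → ℚ[T;T⁻¹]) :
    (coloredWeight ρ).IsInvariant := by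
  classical
  intro V W _ _ G H e r
  rw [coloredWeight, coloredWeight]
  refine Fintype.sum_equiv (e.toEquiv.symm.arrowCongr (Equiv.refl _)) _ _ fun c => ?_
  have hc : e.toEquiv.symm.arrowCongr (Equiv.refl _) c = c ∘ e := rfl
  rw [hc, card_blackNeighbors_iso]
  congr 1
  symm
  refine Finset.prod_bij (fun v _ => e v) ?_ (fun _ _ _ _ h => e.injective h) ?_ ?_
  · intro v hv
    simpa using hv
  · intro v hv
    obtain ⟨v, rfl⟩ := e.surjective v
    exact ⟨v, by simpa using hv, rfl⟩
  · intro v _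
    rw [card_blackNeighbors_iso]
    rfl

open Classical in
theorem card_blackNeighbors_join_inl {V W : Type} [Fintype V] [Fintype W] (G : SimpleGraph V)
    (H : SimpleGraph W) (r : V) (u : W) (c₁ : Coloring V) (c₂ : Coloring W) (v : V) :
    (blackNeighbors (join G H r u) (Sum.elim c₁ c₂) (Sum.inl v)).card =
      (blackNeighbors G c₁ v).card + if v = r ∧ c₂ u = 1 then 1 else 0 := by
  simp only [blackNeighbors, Finset.card_filter, Fintype.sum_sum_type, Sum.elim_inl, Sum.elim_inr,
    join_adj_inl_inl, join_adj_inl_inr]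
  congr 1
  rw [Finset.sum_eq_single u]
  · simp [and_comm]
  · intro b _ hb
    simp [hb]
  · simp

open Classical in
theorem card_blackNeighbors_join_inr {V W : Type} [Fintype V] [Fintype W] (G : SimpleGraph V)
    (H : SimpleGraph W) (r : V) (u : W) (c₁ : Coloring V) (c₂ : Coloring W) (w : W) :
    (blackNeighbors (join G H r u) (Sum.elim c₁ c₂) (Sum.inr w)).card =
      (blackNeighbors H c₂ w).card + if w = u ∧ c₁ r = 1 then 1 else 0 := by
  simp only [blackNeighbors, Finset.card_filter, Fintype.sum_sum_type, Sum.elim_inl, Sum.elim_inr,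
    join_adj_inr_inr, join_adj_inr_inl]
  rw [add_comm]
  congr 1
  rw [Finset.sum_eq_single r]
  · simp [and_comm]
  · intro b _ hb
    simp [hb]
  · simp

/-- A coloring of the join is a pair of colorings, and the new edge changes the number of black
neighbors only at `r` and `u`. So only the factors at these two vertices need to be compared, which
is `h` with `a` the color of `r` and `b` that of `u`. -/
theorem coloredWeight_isProduct {ρ σ : ZMod 2 → ℕ → ℚ[T;T⁻¹]}
    (h : ∀ (a b : ZMod 2) (m n : ℕ), ρ a (m + if b = 1 then 1 else 0) *
      vertexFactor b (n + if a = 1 then 1 else 0) = ρ a m * σ b n) :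
    (coloredWeight ρ).IsProduct (coloredWeight ρ) (coloredWeight σ) := by
  classical
  intro V W _ _ G H r u
  simp only [coloredWeight_apply]
  rw [Finset.sum_mul_sum, ← Finset.sum_product', Finset.univ_product_univ]
  refine Fintype.sum_equiv (Equiv.sumArrowEquivProdArrow V W (ZMod 2)) _ _ fun c => ?_
  obtain ⟨⟨c₁, c₂⟩, rfl⟩ := (Equiv.sumArrowEquivProdArrow V W (ZMod 2)).symm.surjective c
  rw [Equiv.apply_symm_apply]
  have hc : (Equiv.sumArrowEquivProdArrow V W (ZMod 2)).symm (c₁, c₂) = Sum.elim c₁ c₂ := rfl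
  have hu : (Finset.univ : Finset (V ⊕ W)).erase (Sum.inl r) =
      (Finset.univ.erase r).disjSum Finset.univ := by
    ext (v | w) <;> simp
  rw [hc, hu, Finset.prod_disjSum, ← Finset.mul_prod_erase Finset.univ _ (Finset.mem_univ u)]
  simp only [card_blackNeighbors_join_inl, card_blackNeighbors_join_inr, Sum.elim_inl,
    Sum.elim_inr, true_and]
  rw [Finset.prod_congr rfl (g := fun v => vertexFactor (c₁ v) (blackNeighbors G c₁ v).card),
    Finset.prod_congr (s₁ := Finset.univ.erase u) rfl
      (g := fun w => vertexFactor (c₂ w) (blackNeighbors H c₂ w).card)]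
  · linear_combination
      (∏ v ∈ Finset.univ.erase r, vertexFactor (c₁ v) (blackNeighbors G c₁ v).card) *
      (∏ w ∈ Finset.univ.erase u, vertexFactor (c₂ w) (blackNeighbors H c₂ w).card) *
      h (c₁ r) (c₂ u) (blackNeighbors G c₁ r).card (blackNeighbors H c₂ u).card
  · intro w hw
    simp [Finset.ne_of_mem_erase hw]
  · intro v hv
    simp [Finset.ne_of_mem_erase hv]

theorem coloredWeight_of_subsingleton (ρ : ZMod 2 → ℕ → ℚ[T;T⁻¹]) (V : Type) [Fintype V]
    [Subsingleton V] (G : SimpleGraph V) (r : V) : coloredWeight ρ V G r = ρ 0 0 + ρ 1 0 := by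
  classical
  have hb (c : Coloring V) : blackNeighbors G c r = ∅ := by
    ext w
    simp [blackNeighbors, Subsingleton.elim w r]
  have : Unique V := ⟨⟨r⟩, fun _ => Subsingleton.elim _ _⟩
  rw [coloredWeight_apply, Fintype.sum_equiv (Equiv.funUnique V (ZMod 2)) _ (fun a => ρ a 0)]
  · exact Fin.sum_univ_two _
  · intro c
    rw [hb, Finset.card_empty, Finset.prod_eq_one, mul_one, Equiv.funUnique_apply,
      Subsingleton.elim default r]
    exact fun v hv => absurd (Subsingleton.elim v r) (Finset.ne_of_mem_erase hv)

/-- The series of the weight `coloredWeight ρ`. -/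
noncomputable def coloredSeries (ρ : ZMod 2 → ℕ → ℚ[T;T⁻¹]) : LSer := (coloredWeight ρ).egf

/-- Three terms match the three kinds of root; shorter combinations take a zero last term. -/
theorem coloredSeries_linear {ρ ρ₁ ρ₂ ρ₃ : ZMod 2 → ℕ → ℚ[T;T⁻¹]} (y₁ y₂ y₃ : ℚ[T;T⁻¹])
    (h : ∀ a m, ρ a m = y₁ * ρ₁ a m + y₂ * ρ₂ a m + y₃ * ρ₃ a m) :
    coloredSeries ρ = PowerSeries.C y₁ * coloredSeries ρ₁ + PowerSeries.C y₂ * coloredSeries ρ₂ +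
      PowerSeries.C y₃ * coloredSeries ρ₃ := by
  have h1 (V : Type) [Fintype V] (G : SimpleGraph V) (r : V) : coloredWeight ρ V G r =
      y₁ * coloredWeight ρ₁ V G r + y₂ * coloredWeight ρ₂ V G r + y₃ * coloredWeight ρ₃ V G r := by
    simp only [coloredWeight, Finset.mul_sum, ← Finset.sum_add_distrib]
    exact Finset.sum_congr rfl fun c _ => by rw [h]; ring
  have h2 (V : Type) [Fintype V] : (coloredWeight ρ).treeSum V =
      y₁ * (coloredWeight ρ₁).treeSum V + y₂ * (coloredWeight ρ₂).treeSum V +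
        y₃ * (coloredWeight ρ₃).treeSum V := by
    simp only [RootedWeight.treeSum, Finset.mul_sum, ← Finset.sum_add_distrib]
    refine Finset.sum_congr rfl fun p _ => ?_
    split_ifs
    · exact h1 _ _ _
    · simp
  ext1 n
  simp only [coloredSeries, RootedWeight.egf, map_add, PowerSeries.coeff_C_mul,
    PowerSeries.coeff_mk, h2, smul_add, mul_smul_comm]

theorem coloredSeries_eq_X_mul_exp {ρ σ : ZMod 2 → ℕ → ℚ[T;T⁻¹]}
    (h : ∀ (a b : ZMod 2) (m n : ℕ), ρ a (m + if b = 1 then 1 else 0) *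
      vertexFactor b (n + if a = 1 then 1 else 0) = ρ a m * σ b n) (h1 : ρ 0 0 + ρ 1 0 = 1) :
    coloredSeries ρ = PowerSeries.X * exp (coloredSeries σ) := by
  rw [coloredSeries, (coloredWeight_isProduct h).egf_eq (coloredWeight_isInvariant _)
    (coloredWeight_isInvariant _) (p := 1)]
  · rw [map_one, one_mul, coloredSeries]
  · intro V _ _ G r
    rw [coloredWeight_of_subsingleton, h1]

theorem constantCoeff_coloredSeries (ρ : ZMod 2 → ℕ → ℚ[T;T⁻¹]) :
    PowerSeries.constantCoeff (coloredSeries ρ) = 0 :=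
  RootedWeight.constantCoeff_egf _

theorem toLaurent_partialBWPoly {V : Type} [Fintype V] (G : SimpleGraph V) (r : V)
    (p : ZMod 2 → ℕ → Prop) [∀ a m, Decidable (p a m)] :
    Polynomial.toLaurent ((partialBWPoly G fun c => p (c r) (blackNeighbors G c r).card).map
        (Int.castRingHom ℚ)) =
      coloredWeight (fun a m => if p a m then vertexFactor a m else 0) V G r := by
  classical
  rw [partialBWPoly, coloredWeight, Polynomial.map_sum, map_sum, Finset.sum_filter]
  refine Finset.sum_congr rfl fun c _ => ?_
  rw [ite_mul, zero_mul]
  congr 1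
  rw [Finset.mul_prod_erase Finset.univ
    (fun v => vertexFactor (c v) (blackNeighbors G c v).card) (Finset.mem_univ r)]
  simp only [coloringWeight, evenWhites, vertexFactor, Polynomial.map_prod, map_prod,
    Polynomial.map_X, Polynomial.toLaurent_X]
  rw [Finset.prod_filter]

theorem toLSer_treeSeries_partialBWPoly (p : ZMod 2 → ℕ → Prop) [∀ a m, Decidable (p a m)] :
    toLSer (treeSeries fun _ T => partialBWPoly T.graph fun c =>
      p (c T.root) (blackNeighbors T.graph c T.root).card) =
      coloredSeries fun a m => if p a m then vertexFactor a m else 0 :=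
  toLSer_treeSeries (coloredWeight_isInvariant _) fun _ T =>
    toLaurent_partialBWPoly T.graph T.root p

/-! ### The functional equations of the tree series -/

theorem zmod_two_cases : ∀ a : ZMod 2, a = 0 ∨ a = 1 := by decide

/-- The series of the rooted trees with white root and an even number of black children. -/
noncomputable abbrev whiteEven : LSer :=
  coloredSeries fun a m => if a = 0 ∧ Even m then vertexFactor a m else 0

/-- The series of the rooted trees with white root and an odd number of black children. -/
noncomputable abbrev whiteOdd : LSer :=
  coloredSeries fun a m => if a = 0 ∧ Odd m then vertexFactor a m else 0

/-- The series of the rooted trees with black root. -/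
noncomputable abbrev black : LSer :=
  coloredSeries fun a m => if a = 1 then vertexFactor a m else 0

theorem toLSer_seriesWhiteEven : toLSer seriesWhiteEven = whiteEven :=
  toLSer_treeSeries_partialBWPoly fun a m => a = 0 ∧ Even m

theorem toLSer_seriesWhiteOdd : toLSer seriesWhiteOdd = whiteOdd :=
  toLSer_treeSeries_partialBWPoly fun a m => a = 0 ∧ Odd m

theorem toLSer_seriesBlack : toLSer seriesBlack = black :=
  toLSer_treeSeries_partialBWPoly fun a _ => a = 1

/-- The series with a white root of factor `1`. -/
noncomputable abbrev whiteRoot : LSer := coloredSeries fun a _ => if a = 0 then 1 else 0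

/-- The series with a white root of factor `(-1) ^ m`, for `m` black children. -/
noncomputable abbrev whiteRootSigned : LSer :=
  coloredSeries fun a m => if a = 0 then (-1) ^ m else 0

/-- A white root does not affect its children, and its own factor ignores them, so each child keeps
its ordinary factor. -/
theorem whiteRoot_eq : whiteRoot = PowerSeries.X * exp (whiteEven + whiteOdd + black) := by
  have h : coloredSeries vertexFactor = whiteEven + whiteOdd + black := by
    rw [coloredSeries_linear 1 1 1 (ρ₁ := fun a m => if a = 0 ∧ Even m then vertexFactor a m else 0)
      (ρ₂ := fun a m => if a = 0 ∧ Odd m then vertexFactor a m else 0)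
      (ρ₃ := fun a m => if a = 1 then vertexFactor a m else 0)]
    · simp only [map_one, one_mul]
    · intro a m
      rcases zmod_two_cases a with rfl | rfl <;> rcases Nat.even_or_odd m with hm | hm <;>
        simp [hm, Nat.not_odd_iff_even.mpr, Nat.not_even_iff_odd.mpr]
  rw [whiteRoot, coloredSeries_eq_X_mul_exp (σ := vertexFactor), h]
  · intro a b m n
    rcases zmod_two_cases a with rfl | rfl <;> simp
  · simp

/-- The sign distributes over the children: each black child brings `-1`. -/
theorem whiteRootSigned_eq :
    whiteRootSigned = PowerSeries.X * exp (whiteEven + whiteOdd - black) := by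
  have h : coloredSeries (fun a m => if a = 1 then -vertexFactor a m else vertexFactor a m) =
      whiteEven + whiteOdd - black := by
    rw [coloredSeries_linear 1 1 (-1)
      (ρ₁ := fun a m => if a = 0 ∧ Even m then vertexFactor a m else 0)
      (ρ₂ := fun a m => if a = 0 ∧ Odd m then vertexFactor a m else 0)
      (ρ₃ := fun a m => if a = 1 then vertexFactor a m else 0)]
    · simp only [map_neg, map_one, one_mul, neg_mul, sub_eq_add_neg]
    · intro a m
      rcases zmod_two_cases a with rfl | rfl <;> rcases Nat.even_or_odd m with hm | hm <;>
        simp [hm, Nat.not_odd_iff_even.mpr, Nat.not_even_iff_odd.mpr]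
  rw [whiteRootSigned, coloredSeries_eq_X_mul_exp
    (σ := fun a m => if a = 1 then -vertexFactor a m else vertexFactor a m), h]
  · intro a b m n
    rcases zmod_two_cases a with rfl | rfl <;> rcases zmod_two_cases b with rfl | rfl <;>
      simp [pow_succ]
  · simp

/-- A black root adds one black neighbor to each child. A white child with an even number of black
children thereby loses its factor `t`, one with an odd number gains it, and black children are
unaffected. -/
theorem black_eq : black = x * exp (tInv * whiteEven + t * whiteOdd + black) := by
  have hT : (LaurentPolynomial.T (-1) * LaurentPolynomial.T 1 : ℚ[T;T⁻¹]) = 1 := by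
    rw [← LaurentPolynomial.T_add, neg_add_cancel, LaurentPolynomial.T_zero]
  have h : coloredSeries (fun a m => vertexFactor a (m + 1)) =
      tInv * whiteEven + t * whiteOdd + black := by
    rw [coloredSeries_linear (LaurentPolynomial.T (-1)) (LaurentPolynomial.T 1) 1
      (ρ₁ := fun a m => if a = 0 ∧ Even m then vertexFactor a m else 0)
      (ρ₂ := fun a m => if a = 0 ∧ Odd m then vertexFactor a m else 0)
      (ρ₃ := fun a m => if a = 1 then vertexFactor a m else 0)]
    · rw [map_one, one_mul]
      rfl
    · intro a m
      rcases zmod_two_cases a with rfl | rfl <;> rcases Nat.even_or_odd m with hm | hm <;>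
        simp [vertexFactor, hm, hT, Nat.not_odd_iff_even.mpr,
          Nat.not_even_iff_odd.mpr]
  conv_lhs => rw [black, coloredSeries_eq_X_mul_exp (σ := fun a m => vertexFactor a (m + 1))
    (by
      intro a b m n
      rcases zmod_two_cases a with rfl | rfl <;> simp [vertexFactor])
    (by simp [vertexFactor]), h]
  rfl

theorem C_half_mul (f : LSer) :
    PowerSeries.C (LaurentPolynomial.C (1 / 2 : ℚ)) * f = (1 / 2 : ℚ) • f := by
  ext1 n
  rw [PowerSeries.coeff_C_mul, coeff_rat_smul, LaurentPolynomial.smul_eq_C_mul]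

theorem half_add_half : LaurentPolynomial.C (1 / 2 : ℚ) + LaurentPolynomial.C (1 / 2 : ℚ) = 1 := by
  rw [← map_add, add_halves, map_one]

/-- The indicator of even `m` is `(1 + (-1) ^ m) / 2`, a combination of two multiplicative root
factors; the prefactor `t` belongs to the root. -/
theorem whiteEven_eq : whiteEven = t * x * exp (whiteEven + whiteOdd) * cosh black := by
  have h : whiteEven = t * ((1 / 2 : ℚ) • (whiteRoot + whiteRootSigned)) := by
    rw [whiteEven, coloredSeries_linear
      (LaurentPolynomial.T 1 * LaurentPolynomial.C (1 / 2 : ℚ))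
      (LaurentPolynomial.T 1 * LaurentPolynomial.C (1 / 2 : ℚ)) 0
      (ρ₁ := fun a _ => if a = 0 then 1 else 0)
      (ρ₂ := fun a m => if a = 0 then (-1) ^ m else 0) (ρ₃ := 0)]
    · rw [← C_half_mul, map_mul, map_zero, t]
      ring
    · intro a m
      rcases zmod_two_cases a with rfl | rfl
      · rcases Nat.even_or_odd m with hm | hm
        · simp only [hm, vertexFactor, hm.neg_one_pow, and_self, if_true]
          linear_combination -LaurentPolynomial.T 1 * half_add_half
        · simp [hm.neg_one_pow, Nat.not_even_iff_odd.mpr hm]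
      · simp
  rw [mul_assoc _ (exp _), exp_mul_cosh (by simp [constantCoeff_coloredSeries])
    (constantCoeff_coloredSeries _)]
  conv_lhs => rw [h, whiteRoot_eq, whiteRootSigned_eq]
  rw [← mul_add, ← mul_smul_comm, ← mul_assoc]
  rfl

/-- Here the indicator is `(1 - (-1) ^ m) / 2`, and the root has factor `1`. -/
theorem whiteOdd_eq : whiteOdd = x * exp (whiteEven + whiteOdd) * sinh black := by
  have h : whiteOdd = (1 / 2 : ℚ) • (whiteRoot - whiteRootSigned) := by
    rw [whiteOdd, coloredSeries_linear
      (LaurentPolynomial.C (1 / 2 : ℚ)) (-LaurentPolynomial.C (1 / 2 : ℚ)) 0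
      (ρ₁ := fun a _ => if a = 0 then 1 else 0)
      (ρ₂ := fun a m => if a = 0 then (-1) ^ m else 0) (ρ₃ := 0)]
    · rw [← C_half_mul, map_neg, map_zero]
      ring
    · intro a m
      rcases zmod_two_cases a with rfl | rfl
      · rcases Nat.even_or_odd m with hm | hm
        · simp [hm.neg_one_pow, Nat.not_odd_iff_even.mpr hm]
        · simp only [hm, vertexFactor, hm.neg_one_pow, and_self, if_true,
            Nat.not_even_iff_odd.mpr hm, and_false, if_false]
          linear_combination -half_add_half
      · simp
  rw [mul_assoc _ (exp _), exp_mul_sinh (by simp [constantCoeff_coloredSeries])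
    (constantCoeff_coloredSeries _)]
  conv_lhs => rw [h, whiteRoot_eq, whiteRootSigned_eq]
  rw [← mul_sub, ← mul_smul_comm]
  rfl

theorem seriesT_eq : seriesT = seriesWhiteEven + seriesWhiteOdd + seriesBlack := by
  have h (n : ℕ) (T : RTree n) : bwPoly T.graph =
      (partialBWPoly T.graph fun c => c T.root = 0 ∧ Even (blackNeighbors T.graph c T.root).card) +
      (partialBWPoly T.graph fun c => c T.root = 0 ∧ Odd (blackNeighbors T.graph c T.root).card) +
      partialBWPoly T.graph fun c => c T.root = 1 := by
    simp only [bwPoly, partialBWPoly, Finset.sum_filter, ← Finset.sum_add_distrib]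
    refine Finset.sum_congr rfl fun c _ => ?_
    rcases zmod_two_cases (c T.root) with hc | hc <;>
      rcases Nat.even_or_odd (blackNeighbors T.graph c T.root).card with hm | hm <;>
      simp [hc, hm, Nat.not_odd_iff_even.mpr, Nat.not_even_iff_odd.mpr]
  ext1 n
  simp only [seriesT, seriesWhiteEven, seriesWhiteOdd, seriesBlack, treeSeries, map_add,
    PowerSeries.coeff_mk, ← Finset.sum_add_distrib, h, Polynomial.map_add, mul_add]

/-! ### Convergence of the recursion -/

section Divisibility

variable {k : ℕ} {f f' g g' : LSer}

theorem dvd_add_sub_add {d : LSer} (hf : d ∣ f - f') (hg : d ∣ g - g') :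
    d ∣ f + g - (f' + g') := by
  rw [add_sub_add_comm]
  exact dvd_add hf hg

theorem dvd_half_smul {d : LSer} (h : d ∣ f) : d ∣ (1 / 2 : ℚ) • f := by
  rw [← C_half_mul]
  exact h.mul_left _

theorem X_pow_dvd_exp_neg_sub_exp_neg (hf : PowerSeries.constantCoeff f = 0)
    (hg : PowerSeries.constantCoeff g = 0) (h : PowerSeries.X ^ k ∣ f - g) :
    PowerSeries.X ^ k ∣ exp (-f) - exp (-g) :=
  X_pow_dvd_exp_sub_exp (by simpa using hf) (by simpa using hg) (by
    rw [← neg_sub']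
    exact (dvd_neg).mpr h)

theorem X_pow_dvd_cosh_sub_cosh (hf : PowerSeries.constantCoeff f = 0)
    (hg : PowerSeries.constantCoeff g = 0) (h : PowerSeries.X ^ k ∣ f - g) :
    PowerSeries.X ^ k ∣ cosh f - cosh g := by
  rw [cosh, cosh, ← smul_sub]
  exact dvd_half_smul (dvd_add_sub_add (X_pow_dvd_exp_sub_exp hf hg h)
    (X_pow_dvd_exp_neg_sub_exp_neg hf hg h))

theorem X_pow_dvd_sinh_sub_sinh (hf : PowerSeries.constantCoeff f = 0)
    (hg : PowerSeries.constantCoeff g = 0) (h : PowerSeries.X ^ k ∣ f - g) :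
    PowerSeries.X ^ k ∣ sinh f - sinh g := by
  rw [sinh, sinh, ← smul_sub, sub_sub_sub_comm]
  exact dvd_half_smul (dvd_sub (X_pow_dvd_exp_sub_exp hf hg h)
    (X_pow_dvd_exp_neg_sub_exp_neg hf hg h))

theorem X_pow_succ_dvd_x_mul_sub (h : PowerSeries.X ^ k ∣ f - g) :
    PowerSeries.X ^ (k + 1) ∣ x * f - x * g := by
  rw [← mul_sub, pow_succ']
  exact mul_dvd_mul_left _ h

end Divisibility

theorem constantCoeff_x_mul (f : LSer) : PowerSeries.constantCoeff (x * f) = 0 := by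
  simp [x]

theorem constantCoeff_recursion
    (a b c : ℕ → LSer)
    (ha0 : a 0 = t * x)
    (hb0 : b 0 = x ^ 2)
    (hc0 : c 0 = x)
    (ha : ∀ i : ℕ, a (i + 1) =
      t * x * exp (a i + b i) * cosh (c i))
    (hb : ∀ i : ℕ, b (i + 1) =
      x * exp (a i + b i) * sinh (c i))
    (hc : ∀ i : ℕ, c (i + 1) =
      x * exp (tInv * a i + t * b i + c i)) (i : ℕ) :
    PowerSeries.constantCoeff (a i) = 0 ∧ PowerSeries.constantCoeff (b i) = 0 ∧
      PowerSeries.constantCoeff (c i) = 0 := by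
  rcases i with _ | i
  · rw [ha0, hb0, hc0]
    simp [x]
  · rw [ha, hb, hc, mul_assoc t, mul_assoc t, mul_assoc x, mul_left_comm t, mul_assoc x]
    exact ⟨constantCoeff_x_mul _, constantCoeff_x_mul _, constantCoeff_x_mul _⟩

/-- The tree series solve the equations of the recursion. `exp`, `cosh` and `sinh` preserve
congruence modulo `x ^ k`, and the prefactor `x` raises the exponent by one. -/
theorem X_pow_dvd_recursion_sub
    (a b c : ℕ → LSer)
    (ha0 : a 0 = t * x)
    (hb0 : b 0 = x ^ 2)
    (hc0 : c 0 = x)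
    (ha : ∀ i : ℕ, a (i + 1) =
      t * x * exp (a i + b i) * cosh (c i))
    (hb : ∀ i : ℕ, b (i + 1) =
      x * exp (a i + b i) * sinh (c i))
    (hc : ∀ i : ℕ, c (i + 1) =
      x * exp (tInv * a i + t * b i + c i)) (i : ℕ) :
    PowerSeries.X ^ (i + 1) ∣ a i - whiteEven ∧ PowerSeries.X ^ (i + 1) ∣ b i - whiteOdd ∧
      PowerSeries.X ^ (i + 1) ∣ c i - black := by
  have h0 := constantCoeff_recursion a b c ha0 hb0 hc0 ha hb hc
  have hA : PowerSeries.constantCoeff whiteEven = 0 := constantCoeff_coloredSeries _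
  have hB : PowerSeries.constantCoeff whiteOdd = 0 := constantCoeff_coloredSeries _
  have hC : PowerSeries.constantCoeff black = 0 := constantCoeff_coloredSeries _
  induction i with
  | zero =>
    obtain ⟨h1, h2, h3⟩ := h0 0
    -- Of the initial values only the vanishing constant terms matter.
    simp [PowerSeries.X_dvd_iff, h1, h2, h3, hA, hB, hC]
  | succ i ih =>
    obtain ⟨h1, h2, h3⟩ := h0 i
    obtain ⟨d1, d2, d3⟩ := ih
    have hab : PowerSeries.X ^ (i + 1) ∣
        exp (a i + b i) - exp (whiteEven + whiteOdd) :=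
      X_pow_dvd_exp_sub_exp (by simp [h1, h2]) (by simp [hA, hB]) (dvd_add_sub_add d1 d2)
    refine ⟨?_, ?_, ?_⟩
    · rw [ha, whiteEven_eq, mul_assoc t, mul_assoc t, mul_assoc t, mul_assoc t, mul_assoc x,
        mul_assoc x, ← mul_sub]
      exact (X_pow_succ_dvd_x_mul_sub
        (dvd_mul_sub_mul hab (X_pow_dvd_cosh_sub_cosh h3 hC d3))).mul_left _
    · rw [hb, whiteOdd_eq, mul_assoc x, mul_assoc x]
      exact X_pow_succ_dvd_x_mul_sub
        (dvd_mul_sub_mul hab (X_pow_dvd_sinh_sub_sinh h3 hC d3))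
    · rw [hc, black_eq]
      refine X_pow_succ_dvd_x_mul_sub (X_pow_dvd_exp_sub_exp (by simp [h1, h2, h3])
        (by simp [hA, hB, hC]) (dvd_add_sub_add (dvd_add_sub_add ?_ ?_) d3))
      · rw [← mul_sub]
        exact d1.mul_left _
      · rw [← mul_sub]
        exact d2.mul_left _

end BlackWhite

theorem theorem4p1
    (a b c : ℕ → BlackWhite.LSer)
    (ha0 : a 0 = BlackWhite.t * BlackWhite.x)
    (hb0 : b 0 = BlackWhite.x ^ 2)
    (hc0 : c 0 = BlackWhite.x)
    (ha : ∀ i : ℕ, a (i + 1) =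
      BlackWhite.t * BlackWhite.x * BlackWhite.exp (a i + b i) * BlackWhite.cosh (c i))
    (hb : ∀ i : ℕ, b (i + 1) =
      BlackWhite.x * BlackWhite.exp (a i + b i) * BlackWhite.sinh (c i))
    (hc : ∀ i : ℕ, c (i + 1) =
      BlackWhite.x * BlackWhite.exp (BlackWhite.tInv * a i + BlackWhite.t * b i + c i)) :
    -- every exponential in the recursion is taken of a series without constant term
    (∀ i : ℕ, PowerSeries.constantCoeff (a i) = 0 ∧ PowerSeries.constantCoeff (b i) = 0 ∧
      PowerSeries.constantCoeff (c i) = 0) ∧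
    ∃ aInf bInf cInf : PowerSeries (Polynomial ℚ),
      BlackWhite.XAdicTendsto a (BlackWhite.toLSer aInf) ∧
      BlackWhite.XAdicTendsto b (BlackWhite.toLSer bInf) ∧
      BlackWhite.XAdicTendsto c (BlackWhite.toLSer cInf) ∧
      BlackWhite.seriesWhiteEven = aInf ∧
      BlackWhite.seriesWhiteOdd = bInf ∧
      BlackWhite.seriesBlack = cInf ∧
      BlackWhite.seriesT = aInf + bInf + cInf := by
  have hdvd := BlackWhite.X_pow_dvd_recursion_sub a b c ha0 hb0 hc0 ha hb hc
  -- Taking the tree series themselves as limits shows that the limits have coefficients in `ℚ[t]`,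
  -- although the recursion involves `t⁻¹`.
  refine ⟨BlackWhite.constantCoeff_recursion a b c ha0 hb0 hc0 ha hb hc,
    BlackWhite.seriesWhiteEven, BlackWhite.seriesWhiteOdd, BlackWhite.seriesBlack, ?_, ?_, ?_,
    rfl, rfl, rfl, BlackWhite.seriesT_eq⟩
  · rw [BlackWhite.toLSer_seriesWhiteEven]
    exact BlackWhite.xAdicTendsto_of_dvd fun i => (hdvd i).1
  · rw [BlackWhite.toLSer_seriesWhiteOdd]
    exact BlackWhite.xAdicTendsto_of_dvd fun i => (hdvd i).2.1
  · rw [BlackWhite.toLSer_seriesBlack]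
    exact BlackWhite.xAdicTendsto_of_dvd fun i => (hdvd i).2.2
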